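/- Let $m,n\ge 1$ be integers and $p=\min\{m,n\}$. For a real $m\times n$ matrix $M$ let $\sigma(M)=(\sigma_1(M),\dots,\sigma_p(M))\in\mathbb{R}^p$ be the vector of its singular values, $\sigma_1(M)\ge\dots\ge\sigma_p(M)\ge 0$, and let $\|M\|_{sp}=\sigma_1(M)$ and $\|M\|_*=\sum_{i=1}^p\sigma_i(M)$. A function of $x\in\mathbb{R}^p$ is called sign- and permutation-invariant if its value does not change when the entries of $x$ are permuted or when the signs of some of them are changed. Then the following hold. (1) Let $q,k\ge 0$ be integers and let $f_1,\dots,f_k:\mathbb{R}^p\times\mathbb{R}^q\to\mathbb{R}$ be functions such that $x\mapsto f_i(x,z)$ is sign- and permutation-invariant for every $i$ and every $z\in\mathbb{R}^q$. Put $S=\{(x,z)\in\mathbb{R}^p\times\mathbb{R}^q : f_i(x,z)\le 1,\ i=1,\dots,k\}$. Then $$\operatorname{conv}\{(M,z)\in\mathbb{R}^{m\times n}\times\mathbb{R}^q : f_i(\sigma(M),z)\le 1,\ i=1,\dots,k\}=\{(M,z)\in\mathbb{R}^{m\times n}\times\mathbb{R}^q : (\sigma(M),z)\in\operatorname{conv}(S)\}.$$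 (2) Let $\|\cdot\|_s$ be a sign- and permutation-invariant norm on $\mathbb{R}^p$, let $K\ge 1$ be an integer and $r\in\mathbb{R}$. Let $N=\{x\in\mathbb{R}^p : \|x\|_s\le 1,\ x\text{ has at most }K\text{ nonzero entries}\}$, and let $\|x\|_c=\inf\{t>0 : x/t\in\operatorname{conv}(N)\}$ be the norm with unit ball $\operatorname{conv}(N)$. Then $$\operatorname{conv}\{M\in\mathbb{R}^{m\times n} : \operatorname{rank}M\le K,\ \|\sigma(M)\|_s\le r\}=\{M\in\mathbb{R}^{m\times n} : \|\sigma(M)\|_c\le r\}.$$ (3) For every integer $K\ge 0$ and every $r\in\mathbb{R}$, $$\operatorname{conv}\{M\in\mathbb{R}^{m\times n} : \operatorname{rank}M\le K,\ \|M\|_{sp}\le r\}=\{M\in\mathbb{R}^{m\times n} : \|M\|_*\le rK,\ \|M\|_{sp}\le r\}.$$ -/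

import Mathlib

namespace SingularHull

/-- A real function of a vector `x ∈ ℝᵖ` is sign- and permutation-invariant if its value does not
change when the entries of `x` are permuted or when the signs of some entries are changed. -/
def SignPermInvariant {p : ℕ} (g : (Fin p → ℝ) → ℝ) : Prop :=
  (∀ (π : Equiv.Perm (Fin p)) (x : Fin p → ℝ), g (x ∘ π) = g x) ∧
    ∀ x y : Fin p → ℝ, (∀ i, |x i| = |y i|) → g x = g y

/-- The vector `σ(M) = (σ₁(M), …, σ_p(M))`, `p = min m n`, of the singular values of a real
`m × n` matrix, in nonincreasing order and with multiplicity. (Mathlib's sequence of singular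
values starts at index `0` and is nonincreasing; its entries beyond `min m n` vanish.) -/
noncomputable def sigma {m n : ℕ} (M : Matrix (Fin m) (Fin n) ℝ) : Fin (min m n) → ℝ :=
  fun i => (Matrix.toEuclideanLin M).singularValues (i : ℕ)

/-- The spectral norm `‖M‖_sp = σ₁(M)`, the largest singular value. -/
noncomputable def spectralNorm {m n : ℕ} (M : Matrix (Fin m) (Fin n) ℝ) : ℝ :=
  (Matrix.toEuclideanLin M).singularValues 0

/-- The nuclear norm `‖M‖_*`, the sum of the singular values. -/
noncomputable def nuclearNorm {m n : ℕ} (M : Matrix (Fin m) (Fin n) ℝ) : ℝ :=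
  ∑ i, sigma M i

/-- The number of nonzero entries of a vector. -/
noncomputable def card {p : ℕ} (x : Fin p → ℝ) : ℕ :=
  (Function.support x).ncard

/-- The set `N^K = {x ∈ ℝᵖ : ‖x‖_s ≤ 1, card x ≤ K}` of sparse vectors in the unit ball. -/
def sparseBall {p : ℕ} (s : Seminorm ℝ (Fin p → ℝ)) (K : ℕ) : Set (Fin p → ℝ) :=
  {x | s x ≤ 1 ∧ card x ≤ K}

/-- The norm `‖x‖_c = inf {t > 0 : x / t ∈ conv N^K}` whose unit ball is `conv N^K`. -/
noncomputable def cNorm {p : ℕ} (s : Seminorm ℝ (Fin p → ℝ)) (K : ℕ) (x : Fin p → ℝ) : ℝ :=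
  gauge (convexHull ℝ (sparseBall s K)) x

end SingularHull

/-! Fix a singular value decomposition `M = W * diagonal (sigma M) * Zᵀ`. Both inclusions of (1)
come from a linear map built from `W` and `Z`. The map `x ↦ W * diagonal x * Zᵀ` sends `sigma M` to
`M`. It sends `S` into the matrix set, because the singular values of the image are the `|x i|` in
some order. Conversely, `A ↦ (Wᵀ * A * Z).diag` sends `M` to `sigma M`. If `A = P * diagonal (sigma
A) * Qᵀ`, the image of `A` is `T *ᵥ sigma A` with `T i k = (Wᵀ * P) i k * (Zᵀ * Q) i k`. By Bessel's
inequality the absolute row and column sums of `T` are at most one, so Birkhoff's theorem puts `T *ᵥ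
sigma A` in the hull of signed, permuted, shrunken copies of `sigma A`, hence in `conv S`
(`InvariantSet.diag_mem_convexHull`). Since the rank is the number of nonzero singular values, (2)
and (3) reduce to hulls of sparse vectors: (2) follows by scaling and compactness of `conv N`, (3)
by a second use of Birkhoff's theorem (`convexHull_card_le_abs_le`). -/

namespace SingularHull

open Matrix

/-! ### Birkhoff's theorem for substochastic matrices, and invariant sets. -/

section

/-- A `0`-`1` matrix with at most one nonzero entry in every row and column, presented as an
off-diagonal block of a permutation matrix. -/
def IsPartialPerm {ι κ : Type*} [DecidableEq ι] [DecidableEq κ] (B : Matrix ι κ ℝ) : Prop :=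
  ∃ π : Equiv.Perm (ι ⊕ κ), ∀ i j, B i j = if π (Sum.inl i) = Sum.inr j then 1 else 0

/-- A rectangular matrix with nonnegative entries and row and column sums at most one is a convex
combination of partial permutation matrices. -/
theorem mem_convexHull_isPartialPerm {ι κ : Type*} [Fintype ι] [Fintype κ] [DecidableEq ι]
    [DecidableEq κ] {A : Matrix ι κ ℝ} (h0 : ∀ i j, 0 ≤ A i j) (hr : ∀ i, ∑ j, A i j ≤ 1)
    (hc : ∀ j, ∑ i, A i j ≤ 1) : A ∈ convexHull ℝ {B : Matrix ι κ ℝ | IsPartialPerm B} := by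
  -- Dilation to a doubly stochastic matrix: the deficits of the row and column sums go on the
  -- diagonal. The upper right block of a Birkhoff decomposition of `D` then decomposes `A`.
  set D : Matrix (ι ⊕ κ) (ι ⊕ κ) ℝ :=
    fromBlocks (diagonal fun i => 1 - ∑ j, A i j) A Aᵀ (diagonal fun j => 1 - ∑ i, A i j) with hD
  have hDs : D ∈ doublyStochastic ℝ (ι ⊕ κ) := by
    rw [mem_doublyStochastic_iff_sum]
    refine ⟨?_, ?_, ?_⟩
    · rintro (i | i) (j | j)
      · simp only [hD, fromBlocks_apply₁₁, diagonal_apply]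
        split_ifs
        · linarith [hr i]
        · rfl
      · exact h0 i j
      · exact h0 j i
      · simp only [hD, fromBlocks_apply₂₂, diagonal_apply]
        split_ifs
        · linarith [hc i]
        · rfl
    · rintro (i | i) <;> simp [hD, diagonal_apply]
    · rintro (i | i) <;> simp [hD, diagonal_apply]
  obtain ⟨w, hw0, hw1, hw⟩ := exists_eq_sum_perm_of_mem_doublyStochastic hDs
  refine mem_convexHull_of_exists_fintype w
    (fun π : Equiv.Perm (ι ⊕ κ) => of fun i j => if π (Sum.inl i) = Sum.inr j then (1 : ℝ) else 0)
    hw0 hw1 (fun π => ⟨π, fun i j => rfl⟩) ?_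
  ext i j
  have := congrFun (congrFun hw (Sum.inl i)) (Sum.inr j)
  simp only [hD, fromBlocks_apply₁₂] at this
  rw [← this]
  simp [Matrix.sum_apply, Equiv.toPEquiv_apply, eq_comm]

/-- A set of pairs is invariant if membership is not affected by permutations and sign changes of
the first component. -/
def InvariantSet {p : ℕ} {E : Type*} (S : Set ((Fin p → ℝ) × E)) : Prop :=
  ∀ (π : Equiv.Perm (Fin p)) (x y : Fin p → ℝ) (z : E), (∀ i, |x i| = |y (π i)|) →
    (y, z) ∈ S → (x, z) ∈ S

variable {p : ℕ} {E : Type*} [AddCommGroup E] [Module ℝ E] {S : Set ((Fin p → ℝ) × E)}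

/-- A box is the hull of its corners, and the corners `±|y (π i)|` belong to `S` by invariance. -/
theorem InvariantSet.mem_convexHull_of_abs_le (hS : InvariantSet S) (π : Equiv.Perm (Fin p))
    {x y : Fin p → ℝ} {z : E} (h : ∀ i, |x i| ≤ |y (π i)|) (hy : (y, z) ∈ S) :
    (x, z) ∈ convexHull ℝ S := by
  have hx : x ∈ convexHull ℝ (Set.univ.pi fun i => ({-|y (π i)|, |y (π i)|} : Set ℝ)) := by
    refine mem_convexHull_pi fun i _ => ?_
    rw [convexHull_pair, segment_eq_Icc (by linarith [abs_nonneg (y (π i))])]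
    exact abs_le.1 (h i)
  refine convexHull_mono ?_ (mk_mem_convexHull_prod hx (subset_convexHull ℝ {z} rfl))
  rintro ⟨x', z'⟩ ⟨hx', rfl⟩
  refine hS π _ _ _ (fun i => ?_) hy
  have : x' i = -|y (π i)| ∨ x' i = |y (π i)| := hx' i trivial
  rcases this with h | h <;> rw [h] <;> simp

/-- The nonzero entries of a partial permutation matrix lie on the graph of a permutation. -/
theorem IsPartialPerm.exists_perm {B : Matrix (Fin p) (Fin p) ℝ} (hB : IsPartialPerm B) :
    ∃ τ : Equiv.Perm (Fin p), ∀ i j, B i j = 0 ∨ (B i j = 1 ∧ j = τ i) := by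
  obtain ⟨π, hπ⟩ := hB
  -- The rows with an entry `1` map injectively to columns; this partial injection extends to a
  -- permutation.
  obtain ⟨g, hg⟩ := Finset.exists_equiv_extend_of_card_eq (α := Fin p) (β := Fin p)
    (t := Finset.univ) (by simp) (s := Finset.univ.filter fun i => (π (Sum.inl i)).isRight)
    (f := fun i => Sum.elim id id (π (Sum.inl i))) (by simp) (by
      intro i hi j hj hij
      simp only [Finset.coe_filter, Finset.mem_univ, true_and, Set.mem_ofPred_eq,
        Sum.isRight_iff] at hi hj
      obtain ⟨a, ha⟩ := hi
      obtain ⟨b, hb⟩ := hj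
      simp only [ha, hb, Sum.elim_inr, id] at hij
      exact Sum.inl_injective (π.injective (by rw [ha, hb, hij])))
  refine ⟨g.trans (Equiv.subtypeUnivEquiv (by simp)), fun i j => ?_⟩
  rw [hπ]
  split_ifs with h
  · exact Or.inr ⟨rfl, by simpa [h, eq_comm] using hg i (by simp [h])⟩
  · exact Or.inl rfl

theorem InvariantSet.mulVec_mem_convexHull (hS : InvariantSet S) {T : Matrix (Fin p) (Fin p) ℝ}
    (hr : ∀ i, ∑ j, |T i j| ≤ 1) (hc : ∀ j, ∑ i, |T i j| ≤ 1) {v : Fin p → ℝ} {z : E}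
    (hv : (v, z) ∈ S) : (T *ᵥ v, z) ∈ convexHull ℝ S := by
  -- The signs of `T` are absorbed into `L`, so that Birkhoff's theorem is needed only for `|T|`.
  let L : Matrix (Fin p) (Fin p) ℝ →ₗ[ℝ] (Fin p → ℝ) :=
    { toFun := fun B i => ∑ j, B i j * (SignType.sign (T i j) * v j)
      map_add' := fun B C => by ext i; simp [add_mul, Finset.sum_add_distrib]
      map_smul' := fun c B => by ext i; simp [mul_assoc, Finset.mul_sum] }
  have hA := mem_convexHull_isPartialPerm (A := of fun i j => |T i j|)
    (fun i j => abs_nonneg _) hr hc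
  have hL : L (of fun i j => |T i j|) = T *ᵥ v := by
    ext i
    simp only [L, LinearMap.coe_mk, AddHom.coe_mk, of_apply, mulVec, dotProduct]
    refine Finset.sum_congr rfl fun j _ => ?_
    rw [← mul_assoc, abs_mul_sign]
  have hmem : T *ᵥ v ∈ convexHull ℝ (L '' {B | IsPartialPerm B}) := by
    rw [← L.image_convexHull, ← hL]
    exact Set.mem_image_of_mem L hA
  refine convexHull_min ?_ (convex_convexHull ℝ S)
    (mk_mem_convexHull_prod hmem (subset_convexHull ℝ {z} rfl))
  rintro ⟨_, _⟩ ⟨⟨B, hB, rfl⟩, rfl⟩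
  obtain ⟨τ, hτ⟩ := IsPartialPerm.exists_perm hB
  refine hS.mem_convexHull_of_abs_le τ (fun i => ?_) hv
  have : L B i = B i (τ i) * (SignType.sign (T i (τ i)) * v (τ i)) := by
    refine Finset.sum_eq_single (τ i) (fun j _ hj => ?_) fun h => absurd (Finset.mem_univ _) h
    rcases hτ i j with h | h
    · simp [h]
    · exact absurd h.2 hj
  rw [this, abs_mul, abs_mul, ← mul_assoc]
  refine mul_le_of_le_one_left (abs_nonneg _) (mul_le_one₀ ?_ (abs_nonneg _) ?_)
  · rcases hτ i (τ i) with h | ⟨h, -⟩ <;> rw [h] <;> norm_num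
  · rcases lt_trichotomy (T i (τ i)) 0 with h | h | h <;> simp [h]

/-- Vectors whose multisets of entries agree are permutations of each other. -/
theorem exists_perm_of_map_univ_eq {f g : Fin p → ℝ}
    (h : Finset.univ.val.map f = Finset.univ.val.map g) :
    ∃ π : Equiv.Perm (Fin p), ∀ i, f i = g (π i) := by
  rw [Fin.univ_val_map, Fin.univ_val_map, Multiset.coe_eq_coe] at h
  have hfg : f ∘ Tuple.sort f = g ∘ Tuple.sort g := by
    rw [← List.ofFn_inj]
    refine List.Perm.eq_of_pairwise' (r := (· ≤ ·)) ?_ ?_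
      (((Tuple.sort f).ofFn_comp_perm f).trans (h.trans ((Tuple.sort g).ofFn_comp_perm g).symm))
    · exact (Tuple.monotone_sort f).sortedLE_ofFn.pairwise
    · exact (Tuple.monotone_sort g).sortedLE_ofFn.pairwise
  refine ⟨(Tuple.sort f).symm.trans (Tuple.sort g), fun i => ?_⟩
  simpa using congrFun hfg ((Tuple.sort f).symm i)

end

/-! ### Uniqueness and existence of singular value decompositions. -/

section

variable {m n p : ℕ}

/-- The multiset of squared coefficients in a singular value decomposition is unique. -/
theorem map_sq_eq_of_mul_diagonal_mul_eq {W W' : Matrix (Fin m) (Fin p) ℝ}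
    {Z Z' : Matrix (Fin n) (Fin p) ℝ} (hW : Wᵀ * W = 1) (hW' : W'ᵀ * W' = 1) (hZ : Zᵀ * Z = 1)
    (hZ' : Z'ᵀ * Z' = 1) {x y : Fin p → ℝ}
    (h : W * diagonal x * Zᵀ = W' * diagonal y * Z'ᵀ) :
    Finset.univ.val.map (fun i => x i ^ 2) = Finset.univ.val.map (fun i => y i ^ 2) := by
  -- The characteristic polynomials of `X * Y` and `Y * X` agree up to powers of the variable. With
  -- `X = Z` and `Zᵀ * Z = 1`, the second product is diagonal.
  have key : ∀ (W : Matrix (Fin m) (Fin p) ℝ) (Z : Matrix (Fin n) (Fin p) ℝ) (x : Fin p → ℝ),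
      Wᵀ * W = 1 → Zᵀ * Z = 1 →
      Polynomial.X ^ p * ((W * diagonal x * Zᵀ)ᵀ * (W * diagonal x * Zᵀ)).charpoly =
        Polynomial.X ^ n * ∏ i, (Polynomial.X - Polynomial.C (x i ^ 2)) := by
    intro W Z x hW hZ
    have h1 : (W * diagonal x * Zᵀ)ᵀ * (W * diagonal x * Zᵀ) =
        Z * (diagonal (fun i => x i ^ 2) * Zᵀ) := by
      calc _ = Z * diagonal x * (Wᵀ * W) * (diagonal x * Zᵀ) := by
            simp only [transpose_mul, transpose_transpose, diagonal_transpose, Matrix.mul_assoc]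
        _ = Z * ((diagonal x * diagonal x) * Zᵀ) := by
            rw [hW, Matrix.mul_one]; simp only [Matrix.mul_assoc]
        _ = _ := by rw [diagonal_mul_diagonal]; simp only [sq]
    have h2 := charpoly_mul_comm' Z (diagonal (fun i => x i ^ 2) * Zᵀ)
    rw [Matrix.mul_assoc, hZ, Matrix.mul_one, charpoly_diagonal] at h2
    rw [h1]
    simpa using h2
  have h3 : (∏ i, (Polynomial.X - Polynomial.C (x i ^ 2)) : Polynomial ℝ) =
      ∏ i, (Polynomial.X - Polynomial.C (y i ^ 2)) := by
    have := key W Z x hW hZ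
    rw [h, key W' Z' y hW' hZ'] at this
    exact (mul_left_cancel₀ (pow_ne_zero _ Polynomial.X_ne_zero) this).symm
  have hroots : ∀ x : Fin p → ℝ, (∏ i, (Polynomial.X - Polynomial.C (x i ^ 2))).roots =
      Finset.univ.val.map (fun i => x i ^ 2) := fun x => by
    rw [Polynomial.roots_prod _ _
      (Finset.prod_ne_zero_iff.2 fun i _ => Polynomial.X_sub_C_ne_zero _)]
    simp only [Polynomial.roots_X_sub_C, Multiset.bind_singleton]
  rw [← hroots, ← hroots, h3]

/-- Singular value decomposition. -/
theorem exists_svd (M : Matrix (Fin m) (Fin n) ℝ) :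
    ∃ (W : Matrix (Fin m) (Fin (min m n)) ℝ) (Z : Matrix (Fin n) (Fin (min m n)) ℝ),
      Wᵀ * W = 1 ∧ Zᵀ * Z = 1 ∧ M = W * diagonal (sigma M) * Zᵀ := by
  set T := Matrix.toEuclideanLin M with hT
  have hn : Module.finrank ℝ (EuclideanSpace ℝ (Fin n)) = n := by simp
  have hm : Module.finrank ℝ (EuclideanSpace ℝ (Fin m)) = m := by simp
  set v := T.isSymmetric_adjoint_comp_self.eigenvectorBasis hn with hv
  have hinner : ∀ i j, inner ℝ (T (v i)) (T (v j)) =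
      if i = j then T.singularValues i ^ 2 else 0 := by
    intro i j
    rw [← LinearMap.adjoint_inner_right, ← LinearMap.comp_apply,
      T.isSymmetric_adjoint_comp_self.apply_eigenvectorBasis hn j, inner_smul_right, ← hv,
      orthonormal_iff_ite.1 v.orthonormal i j, T.sq_singularValues_fin hn i]
    split_ifs with h
    · simp [h]
    · simp
  have hzero : ∀ j : ℕ, m ≤ j → T.singularValues j = 0 := fun j hj => by
    rw [LinearMap.singularValues_eq_zero_iff_le_finrank_range]
    exact ((Submodule.finrank_le _).trans hm.le).trans hj
  have hTv0 : ∀ j : Fin n, T.singularValues j = 0 → T (v j) = 0 := fun j hj => by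
    have := hinner j j
    rw [hj] at this
    simpa using this
  -- Only indices with nonzero singular value matter: there `i < n` holds automatically, and these
  -- vectors are orthonormal. The rest is replaced by the extension to a basis.
  let u₀ : Fin m → EuclideanSpace ℝ (Fin m) := fun i =>
    if h : (i : ℕ) < n then (T.singularValues i)⁻¹ • T (v ⟨i, h⟩) else 0
  have hu₀ : Orthonormal ℝ (({i : Fin m | T.singularValues i ≠ 0}).domRestrict u₀) := by
    rw [orthonormal_iff_ite]
    rintro ⟨i, hi⟩ ⟨j, hj⟩
    have hin : (i : ℕ) < n := by
      by_contra h
      exact hi (T.singularValues_of_finrank_le (by simpa using h))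
    have hjn : (j : ℕ) < n := by
      by_contra h
      exact hj (T.singularValues_of_finrank_le (by simpa using h))
    simp only [Set.domRestrict_apply, u₀, hin, hjn, dif_pos, inner_smul_left, inner_smul_right,
      hinner, Subtype.mk.injEq, Fin.mk.injEq, Fin.val_inj]
    split_ifs with h
    · subst h
      have : T.singularValues i ≠ 0 := hi
      simp
      field_simp
    · simp
  obtain ⟨u, hu⟩ := hu₀.exists_orthonormalBasis_extension_of_card_eq (by simp)
  have hTv : ∀ j : Fin n, ∀ h : (j : ℕ) < m, T (v j) = T.singularValues j • u ⟨j, h⟩ := by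
    intro j h
    by_cases h0 : T.singularValues j = 0
    · rw [h0, hTv0 j h0, zero_smul]
    · rw [hu ⟨j, h⟩ h0]
      simp [u₀, smul_smul, h0]
  have horth : ∀ {k : ℕ} (b : OrthonormalBasis (Fin k) ℝ (EuclideanSpace ℝ (Fin k)))
      (f : Fin (min m n) → Fin k), Function.Injective f →
      (of fun i j => b (f j) i : Matrix (Fin k) (Fin (min m n)) ℝ)ᵀ * (of fun i j => b (f j) i)
        = 1 := by
    intro k b f hf
    ext i j
    have := orthonormal_iff_ite.1 b.orthonormal (f i) (f j)
    rw [EuclideanSpace.inner_eq_star_dotProduct] at this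
    simp only [mul_apply, transpose_apply, of_apply, one_apply, ← hf.eq_iff, ← this, dotProduct]
    exact Finset.sum_congr rfl fun _ _ => by simp [mul_comm]
  refine ⟨of fun i j => u (Fin.castLE (min_le_left _ _) j) i,
    of fun i j => v (Fin.castLE (min_le_right _ _) j) i,
    horth u _ (Fin.castLE_injective _), horth v _ (Fin.castLE_injective _), ?_⟩
  ext i k
  have h1 : M i k = T (EuclideanSpace.single k 1) i := by simp [hT]
  have h2 : T (EuclideanSpace.single k 1) = ∑ j, v j k • T (v j) := by
    conv_lhs => rw [← v.sum_repr' (EuclideanSpace.single k 1)]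
    simp [EuclideanSpace.inner_single_right]
  have h3 : ∑ j, v j k • T (v j) =
      ∑ j : Fin (min m n), (v (Fin.castLE (min_le_right _ _) j) k * sigma M j) •
        u (Fin.castLE (min_le_left _ _) j) := by
    symm
    refine Finset.sum_of_injOn (Fin.castLE (min_le_right m n)) (Fin.castLE_injective _).injOn
      (by simp) (fun j _ hj => ?_) (fun j _ => ?_)
    · have : m ≤ j := by
        by_contra h
        exact hj ⟨⟨j, lt_min (not_le.1 h) j.2⟩, by simp, rfl⟩
      rw [hTv0 j (hzero j this), smul_zero]
    · rw [hTv _ (lt_of_lt_of_le j.2 (min_le_left _ _)), mul_smul]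
      rfl
  rw [h1, h2, h3]
  simp only [WithLp.ofLp_sum, Finset.sum_apply, mul_apply (N := _ᵀ), mul_diagonal, transpose_apply,
    of_apply, WithLp.ofLp_smul, Pi.smul_apply, smul_eq_mul]
  exact Finset.sum_congr rfl fun _ _ => by ring

end

/-! ### Transfer of convex hulls between vectors and matrices. -/

section

variable {m n p : ℕ}

theorem sigma_nonneg (M : Matrix (Fin m) (Fin n) ℝ) (i : Fin (min m n)) : 0 ≤ sigma M i :=
  LinearMap.singularValues_nonneg _ _

/-- The singular values of a matrix given by a singular value decomposition with unordered
coefficients of arbitrary sign. -/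
theorem exists_sigma_eq_abs {W : Matrix (Fin m) (Fin (min m n)) ℝ}
    {Z : Matrix (Fin n) (Fin (min m n)) ℝ} (hW : Wᵀ * W = 1) (hZ : Zᵀ * Z = 1)
    (x : Fin (min m n) → ℝ) :
    ∃ π : Equiv.Perm (Fin (min m n)), ∀ i, sigma (W * diagonal x * Zᵀ) i = |x (π i)| := by
  obtain ⟨W', Z', hW', hZ', h⟩ := exists_svd (W * diagonal x * Zᵀ)
  obtain ⟨π, hπ⟩ := exists_perm_of_map_univ_eq
    (map_sq_eq_of_mul_diagonal_mul_eq hW' hW hZ' hZ h.symm)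
  refine ⟨π, fun i => ?_⟩
  rw [← abs_of_nonneg (sigma_nonneg _ i)]
  exact (sq_eq_sq_iff_abs_eq_abs _ _).1 (hπ i)

/-- Bessel's inequality for a matrix with orthonormal columns. -/
theorem transpose_mulVec_dotProduct_self_le {P : Matrix (Fin m) (Fin p) ℝ} (hP : Pᵀ * P = 1)
    (w : Fin m → ℝ) : (Pᵀ *ᵥ w) ⬝ᵥ (Pᵀ *ᵥ w) ≤ w ⬝ᵥ w := by
  set c := Pᵀ *ᵥ w with hc
  have h1 : w ⬝ᵥ (P *ᵥ c) = c ⬝ᵥ c := by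
    rw [dotProduct_mulVec, ← mulVec_transpose]
  have h2 : (P *ᵥ c) ⬝ᵥ (P *ᵥ c) = c ⬝ᵥ c := by
    rw [dotProduct_mulVec, ← mulVec_transpose, mulVec_mulVec, hP, one_mulVec]
  have h3 : 0 ≤ (w - P *ᵥ c) ⬝ᵥ (w - P *ᵥ c) :=
    Finset.sum_nonneg fun i _ => mul_self_nonneg _
  rw [sub_dotProduct, dotProduct_sub, dotProduct_sub, dotProduct_comm (P *ᵥ c) w, h1, h2] at h3
  linarith

/-- Row `i` of `Wᵀ * P` holds the coefficients of a unit vector, column `i` of `W`, in the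
orthonormal columns of `P`. -/
theorem sum_sq_transpose_mul_le_one {W P : Matrix (Fin m) (Fin p) ℝ} (hW : Wᵀ * W = 1)
    (hP : Pᵀ * P = 1) (i : Fin p) : ∑ k, (Wᵀ * P) i k ^ 2 ≤ 1 := by
  have h := transpose_mulVec_dotProduct_self_le hP (fun j => W j i)
  have h1 : (fun j => W j i) ⬝ᵥ (fun j => W j i) = 1 := by
    simpa [mul_apply, dotProduct] using congrFun (congrFun hW i) i
  rw [h1] at h
  refine le_trans (le_of_eq ?_) h
  refine Finset.sum_congr rfl fun k _ => ?_
  rw [sq]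
  simp only [mul_apply, mulVec, dotProduct, transpose_apply, mul_comm]

theorem sum_abs_mul_le_one {a b : Fin p → ℝ} (ha : ∑ k, a k ^ 2 ≤ 1) (hb : ∑ k, b k ^ 2 ≤ 1) :
    ∑ k, |a k * b k| ≤ 1 := by
  calc ∑ k, |a k * b k| ≤ ∑ k, (a k ^ 2 + b k ^ 2) / 2 := by
        refine Finset.sum_le_sum fun k _ => ?_
        rw [abs_mul, ← sq_abs (a k), ← sq_abs (b k)]
        linarith [two_mul_le_add_sq |a k| |b k|]
    _ = (∑ k, a k ^ 2 + ∑ k, b k ^ 2) / 2 := by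
        rw [← Finset.sum_div, Finset.sum_add_distrib]
    _ ≤ 1 := by linarith

/-- The diagonal of a matrix in a pair of orthonormal systems lies in the convex hull of every
invariant set that contains the singular values. -/
theorem InvariantSet.diag_mem_convexHull {E : Type*} [AddCommGroup E] [Module ℝ E]
    {S : Set ((Fin (min m n) → ℝ) × E)} (hS : InvariantSet S)
    {W : Matrix (Fin m) (Fin (min m n)) ℝ} {Z : Matrix (Fin n) (Fin (min m n)) ℝ}
    (hW : Wᵀ * W = 1) (hZ : Zᵀ * Z = 1) {A : Matrix (Fin m) (Fin n) ℝ} {z : E}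
    (hA : (sigma A, z) ∈ S) : ((Wᵀ * A * Z).diag, z) ∈ convexHull ℝ S := by
  obtain ⟨P, Q, hP, hQ, h⟩ := exists_svd A
  have key : (Wᵀ * A * Z).diag =
      (of fun i k => (Wᵀ * P) i k * (Zᵀ * Q) i k : Matrix _ _ ℝ) *ᵥ sigma A := by
    have h1 : Wᵀ * A * Z = (Wᵀ * P) * diagonal (sigma A) * (Zᵀ * Q)ᵀ := by
      conv_lhs => rw [h]
      simp only [transpose_mul, transpose_transpose, Matrix.mul_assoc]
    ext i
    rw [h1, diag_apply, mul_apply]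
    simp only [mul_diagonal, mulVec, dotProduct, of_apply, transpose_apply (Zᵀ * Q)]
    exact Finset.sum_congr rfl fun k _ => by ring
  have hswap : ∀ {k : ℕ} (X Y : Matrix (Fin k) (Fin (min m n)) ℝ) (i j : Fin (min m n)),
      (Xᵀ * Y) i j = (Yᵀ * X) j i := fun X Y i j => by
    rw [← transpose_apply (Yᵀ * X), transpose_mul, transpose_transpose]
  rw [key]
  refine hS.mulVec_mem_convexHull (fun i => ?_) (fun j => ?_) hA
  · exact sum_abs_mul_le_one (sum_sq_transpose_mul_le_one hW hP i)
      (sum_sq_transpose_mul_le_one hZ hQ i)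
  · simp only [of_apply, hswap W P _ j, hswap Z Q _ j]
    exact sum_abs_mul_le_one (sum_sq_transpose_mul_le_one hP hW j)
      (sum_sq_transpose_mul_le_one hQ hZ j)

/-- The convex hull of a set described through singular values. -/
theorem InvariantSet.convexHull_sigma_prod {E : Type*} [AddCommGroup E] [Module ℝ E]
    {S : Set ((Fin (min m n) → ℝ) × E)} (hS : InvariantSet S) :
    convexHull ℝ {w : Matrix (Fin m) (Fin n) ℝ × E | (sigma w.1, w.2) ∈ S} =
      {w : Matrix (Fin m) (Fin n) ℝ × E | (sigma w.1, w.2) ∈ convexHull ℝ S} := by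
  ext ⟨M, z⟩
  obtain ⟨W, Z, hW, hZ, hM⟩ := exists_svd M
  constructor
  · intro h
    let L : Matrix (Fin m) (Fin n) ℝ × E →ₗ[ℝ] (Fin (min m n) → ℝ) × E :=
      { toFun := fun w => ((Wᵀ * w.1 * Z).diag, w.2)
        map_add' := fun v w => by simp [Matrix.mul_add, Matrix.add_mul]
        map_smul' := fun c w => by simp }
    have hL : L (M, z) = (sigma M, z) := by
      have : Wᵀ * M * Z = (Wᵀ * W) * diagonal (sigma M) * (Zᵀ * Z) := by
        conv_lhs => rw [hM]
        simp only [Matrix.mul_assoc]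
      simp [L, this, hW, hZ]
    have h1 : L (M, z) ∈ convexHull ℝ (L '' {w | (sigma w.1, w.2) ∈ S}) := by
      rw [← L.image_convexHull]
      exact Set.mem_image_of_mem L h
    rw [hL] at h1
    refine convexHull_min ?_ (convex_convexHull ℝ S) h1
    rintro _ ⟨w, hw, rfl⟩
    exact hS.diag_mem_convexHull hW hZ hw
  · intro h
    let L : (Fin (min m n) → ℝ) × E →ₗ[ℝ] Matrix (Fin m) (Fin n) ℝ × E :=
      { toFun := fun v => (W * diagonal v.1 * Zᵀ, v.2)
        map_add' := fun v w => by
          have : diagonal (v.1 + w.1) = diagonal v.1 + diagonal w.1 := (diagonal_add _ _).symm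
          simp [this, -diagonal_add, Matrix.mul_add, Matrix.add_mul]
        map_smul' := fun c w => by simp [diagonal_smul] }
    have hL : L (sigma M, z) = (M, z) := Prod.ext hM.symm rfl
    have h1 : L (sigma M, z) ∈ convexHull ℝ (L '' S) := by
      rw [← L.image_convexHull]
      exact Set.mem_image_of_mem L h
    rw [hL] at h1
    refine convexHull_mono ?_ h1
    rintro _ ⟨⟨x, y⟩, hx, rfl⟩
    obtain ⟨π, hπ⟩ := exists_sigma_eq_abs hW hZ x
    exact hS π _ x y (fun i => (congrArg abs (hπ i)).trans (abs_abs _)) hx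

theorem convexHull_sigma_mem {A : Set (Fin (min m n) → ℝ)}
    (hA : ∀ (π : Equiv.Perm (Fin (min m n))) (x y : Fin (min m n) → ℝ),
      (∀ i, |x i| = |y (π i)|) → y ∈ A → x ∈ A) :
    convexHull ℝ {M : Matrix (Fin m) (Fin n) ℝ | sigma M ∈ A} =
      {M : Matrix (Fin m) (Fin n) ℝ | sigma M ∈ convexHull ℝ A} := by
  -- A dummy factor `ℝ` brings the set into the form of pairs; the hull of a product is the product
  -- of the hulls.
  have hS : InvariantSet (A ×ˢ (Set.univ : Set ℝ)) :=
    fun π x y z h hy => ⟨hA π x y h hy.1, trivial⟩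
  have h := hS.convexHull_sigma_prod (m := m) (n := n)
  ext M
  have h' := Set.ext_iff.1 h (M, 0)
  have h1 : {w : Matrix (Fin m) (Fin n) ℝ × ℝ | (sigma w.1, w.2) ∈ A ×ˢ (Set.univ : Set ℝ)} =
      {M | sigma M ∈ A} ×ˢ Set.univ := by ext w; simp
  rw [h1, convexHull_prod] at h'
  simpa [convexHull_prod] using h'

theorem SignPermInvariant.apply_eq {g : (Fin p → ℝ) → ℝ} (hg : SignPermInvariant g)
    (π : Equiv.Perm (Fin p)) {x y : Fin p → ℝ} (h : ∀ i, |x i| = |y (π i)|) : g x = g y := by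
  rw [← hg.1 π y]
  exact hg.2 x (y ∘ π) h

theorem card_eq_of_abs_eq (π : Equiv.Perm (Fin p)) {x y : Fin p → ℝ}
    (h : ∀ i, |x i| = |y (π i)|) : card x = card y := by
  have : Function.support x = π ⁻¹' Function.support y := by
    ext i
    simp only [Function.mem_support, Set.mem_preimage, ← abs_ne_zero (a := x i), h i, ne_eq,
      abs_eq_zero]
  rw [card, card, this]
  exact Set.ncard_preimage_of_injective_subset_range π.injective (by simp)

theorem card_sigma (M : Matrix (Fin m) (Fin n) ℝ) : card (sigma M) = M.rank := by
  have hr : Module.finrank ℝ (LinearMap.range (Matrix.toEuclideanLin M)) = M.rank := by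
    rw [Matrix.toEuclideanLin, Matrix.toLpLin_eq_toLin, ← rank_eq_finrank_range_toLin]
  have hle : M.rank ≤ min m n := le_min (rank_le_height M) (rank_le_width M)
  have : Function.support (sigma M) = Set.range (Fin.castLE hle) := by
    ext i
    rw [Function.mem_support, sigma, ← LinearMap.singularValues_pos_iff_ne_zero,
      LinearMap.singularValues_pos_iff_lt_finrank_range, hr, Fin.range_castLE]
    rfl
  rw [card, this, Set.ncard_range_of_injective (Fin.castLE_injective _), Nat.card_fin]

theorem spectralNorm_le_iff (h : 0 < min m n) (M : Matrix (Fin m) (Fin n) ℝ) (r : ℝ) :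
    spectralNorm M ≤ r ↔ ∀ i, sigma M i ≤ r := by
  constructor
  · intro hr i
    exact (LinearMap.singularValues_antitone _ (Nat.zero_le _)).trans hr
  · exact fun hr => hr ⟨0, h⟩

end

/-! ### Convex hulls of sparse vectors. -/

section

open scoped Pointwise

variable {p : ℕ}

theorem isCompact_convexHull_union {V : Type*} [NormedAddCommGroup V] [NormedSpace ℝ V]
    {s t : Set V} (hs : IsCompact s) (ht : IsCompact t) (hs' : Convex ℝ s) (ht' : Convex ℝ t) :
    IsCompact (convexHull ℝ (s ∪ t)) := by
  rcases s.eq_empty_or_nonempty with rfl | hs0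
  · rwa [Set.empty_union, ht'.convexHull_eq]
  rcases t.eq_empty_or_nonempty with rfl | ht0
  · rwa [Set.union_empty, hs'.convexHull_eq]
  have : convexHull ℝ (s ∪ t) = (fun q : (V × V) × ℝ => (1 - q.2) • q.1.1 + q.2 • q.1.2) ''
      ((s ×ˢ t) ×ˢ Set.Icc 0 1) := by
    rw [hs'.convexHull_union ht' hs0 ht0]
    ext x
    simp only [mem_convexJoin, segment_eq_image, Set.mem_image, Set.mem_prod, Prod.exists]
    constructor
    · rintro ⟨a, ha, b, hb, θ, hθ, rfl⟩
      exact ⟨a, b, θ, ⟨⟨ha, hb⟩, hθ⟩, rfl⟩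
    · rintro ⟨a, b, θ, ⟨⟨ha, hb⟩, hθ⟩, rfl⟩
      exact ⟨a, ha, b, hb, θ, hθ, rfl⟩
  rw [this]
  exact ((hs.prod ht).prod isCompact_Icc).image (by fun_prop)

theorem isCompact_convexHull_biUnion {V ι : Type*} [NormedAddCommGroup V] [NormedSpace ℝ V]
    (F : Finset ι) {f : ι → Set V} (hf : ∀ i ∈ F, IsCompact (f i)) (hf' : ∀ i ∈ F, Convex ℝ (f i)) :
    IsCompact (convexHull ℝ (⋃ i ∈ F, f i)) := by
  classical
  induction F using Finset.induction_on with
  | empty => simp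
  | insert a F _ ih =>
    rw [Finset.set_biUnion_insert, ← convexHull_convexHull_union_right]
    exact isCompact_convexHull_union (hf a (by simp))
      (ih (fun i hi => hf i (by simp [hi])) (fun i hi => hf' i (by simp [hi])))
      (hf' a (by simp)) (convex_convexHull ℝ _)

theorem continuous_seminorm (s : Seminorm ℝ (Fin p → ℝ)) : Continuous s := by
  rw [← continuousOn_univ]
  exact s.convexOn.continuousOn isOpen_univ

theorem isCompact_seminorm_le {s : Seminorm ℝ (Fin p → ℝ)} (hs : ∀ x, s x = 0 → x = 0) (r : ℝ) :
    IsCompact {x | s x ≤ r} := by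
  refine Metric.isCompact_of_isClosed_isBounded
    (isClosed_le (continuous_seminorm s) continuous_const) ?_
  rcases (Metric.sphere (0 : Fin p → ℝ) 1).eq_empty_or_nonempty with h | h
  · refine (Bornology.isBounded_singleton (x := (0 : Fin p → ℝ))).subset fun x _ => ?_
    by_contra hx
    have : (‖x‖⁻¹ • x) ∈ Metric.sphere (0 : Fin p → ℝ) 1 := by
      simp [norm_smul, norm_ne_zero_iff.2 hx]
    simp [h] at this
  · obtain ⟨u, hu, hmin⟩ := (isCompact_sphere (0 : Fin p → ℝ) 1).exists_isMinOn h
      (continuous_seminorm s).continuousOn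
    have hu0 : 0 < s u := (apply_nonneg s u).lt_of_ne' fun h0 => by
      rw [hs u h0] at hu
      simp at hu
    refine (Metric.isBounded_closedBall (x := (0 : Fin p → ℝ)) (r := r / s u)).subset
      fun x hx => ?_
    rw [mem_closedBall_zero_iff, le_div_iff₀ hu0]
    by_cases hx0 : x = 0
    · simpa [hx0] using hx
    have hn := norm_ne_zero_iff.2 hx0
    have h1 : s u ≤ s (‖x‖⁻¹ • x) := hmin (by simp [norm_smul, hn])
    rw [map_smul_eq_mul, norm_inv, norm_norm] at h1
    calc ‖x‖ * s u ≤ ‖x‖ * (‖x‖⁻¹ * s x) := by gcongr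
      _ = s x := by field_simp
      _ ≤ r := hx

theorem card_le_card_of_support_subset {x : Fin p → ℝ} {T : Finset (Fin p)}
    (h : ∀ i ∉ T, x i = 0) : card x ≤ T.card := by
  rw [card, ← Set.ncard_coe_finset]
  exact Set.ncard_le_ncard (fun i hi => by_contra fun hT => hi (h i hT)) T.finite_toSet

/-- Sorted by support, the sparse ball is a finite union of compact convex sets. Closedness of the
hull makes its gauge ball the hull itself; boundedness makes the gauge vanish only at `0`. -/
theorem isCompact_convexHull_sparseBall {s : Seminorm ℝ (Fin p → ℝ)} (hs : ∀ x, s x = 0 → x = 0)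
    (K : ℕ) : IsCompact (convexHull ℝ (sparseBall s K)) := by
  have : sparseBall s K = ⋃ T ∈ (Finset.univ : Finset (Finset (Fin p))).filter (·.card ≤ K),
      {x | s x ≤ 1} ∩ {x | ∀ i ∉ T, x i = 0} := by
    ext x
    simp only [sparseBall, Set.mem_ofPred_eq, Finset.mem_filter, Finset.mem_univ, true_and,
      Set.mem_iUnion, Set.mem_inter_iff, exists_prop]
    constructor
    · rintro ⟨h1, h2⟩
      refine ⟨(Function.support x).toFinite.toFinset, ?_, h1, by simp⟩
      rwa [← Set.ncard_eq_toFinset_card]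
    · rintro ⟨T, hT, h1, h2⟩
      exact ⟨h1, (card_le_card_of_support_subset h2).trans hT⟩
  rw [this]
  refine isCompact_convexHull_biUnion _ (fun T _ => ?_) (fun T _ => ?_)
  · refine (isCompact_seminorm_le hs 1).inter_right ?_
    simp only [Set.ofPred_forall]
    exact isClosed_iInter fun i => isClosed_iInter fun _ =>
      isClosed_eq (continuous_apply i) continuous_const
  · refine Convex.inter ?_ ?_
    · have := s.convex_closedBall 0 1
      simpa [Seminorm.closedBall_zero_eq] using this
    · intro x hx y hy a b _ _ _ i hi
      simp [hx i hi, hy i hi]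

theorem convexHull_sparseBall_mem_nhds (hp : 0 < p) (s : Seminorm ℝ (Fin p → ℝ)) {K : ℕ}
    (hK : 1 ≤ K) : convexHull ℝ (sparseBall s K) ∈ nhds (0 : Fin p → ℝ) := by
  have hp' : (p : ℝ) ≠ 0 := by positivity
  have h : ∀ᶠ x : Fin p → ℝ in nhds 0, ∀ i, s (Pi.single i (p * x i)) < 1 := by
    refine Filter.eventually_all.2 fun i => ?_
    have hc : Continuous fun x : Fin p → ℝ => s (Pi.single i (p * x i)) :=
      (continuous_seminorm s).comp ((continuous_single i).comp (by fun_prop))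
    exact hc.continuousAt.eventually_lt continuousAt_const (by simp)
  filter_upwards [h] with x hx
  -- `x` is the average of the `p` vectors `p * x i` along the axes, each `1`-sparse and in the unit
  -- ball when `x` is small.
  refine mem_convexHull_of_exists_fintype (fun _ : Fin p => (p : ℝ)⁻¹)
    (fun i => Pi.single i (p * x i)) (fun _ => by positivity) (by simp [hp']) (fun i => ?_) ?_
  · refine ⟨(hx i).le, (card_le_card_of_support_subset (T := {i}) fun j hj => ?_).trans (by simpa)⟩
    exact Pi.single_eq_of_ne (by simpa using hj) _
  · ext j
    simp [Finset.sum_apply, Pi.single_apply, hp']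

theorem convexHull_card_le_seminorm_le (hp : 0 < p) {s : Seminorm ℝ (Fin p → ℝ)}
    (hs : ∀ x, s x = 0 → x = 0) {K : ℕ} (hK : 1 ≤ K) (r : ℝ) :
    convexHull ℝ {x | card x ≤ K ∧ s x ≤ r} = {x | cNorm s K x ≤ r} := by
  have hC := isCompact_convexHull_sparseBall hs K
  have hnhds := convexHull_sparseBall_mem_nhds hp s hK
  rcases lt_trichotomy r 0 with hr | rfl | hr
  · have h1 : {x | card x ≤ K ∧ s x ≤ r} = ∅ :=
      Set.eq_empty_of_forall_notMem fun x hx => absurd (hx.2.trans_lt hr) (apply_nonneg s x).not_gt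
    have h2 : {x | cNorm s K x ≤ r} = ∅ :=
      Set.eq_empty_of_forall_notMem fun x hx =>
        absurd (lt_of_le_of_lt hx hr) (gauge_nonneg x).not_gt
    rw [h1, h2, convexHull_empty]
  · have h1 : {x | card x ≤ K ∧ s x ≤ 0} = {0} := by
      ext x
      refine ⟨fun hx => hs x (le_antisymm hx.2 (apply_nonneg s x)), ?_⟩
      rintro rfl
      simp [card]
    rw [h1, convexHull_singleton]
    ext x
    rw [Set.mem_ofPred_eq, cNorm, (gauge_nonneg x).ge_iff_eq',
      gauge_eq_zero (absorbent_nhds_zero hnhds)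
        (NormedSpace.isVonNBounded_of_isBounded ℝ hC.isBounded)]
    rfl
  · have h1 : {x | card x ≤ K ∧ s x ≤ r} = r • sparseBall s K := by
      ext x
      rw [Set.mem_smul_set_iff_inv_smul_mem₀ hr.ne', sparseBall, Set.mem_ofPred_eq,
        Set.mem_ofPred_eq, map_smul_eq_mul, norm_inv, Real.norm_of_nonneg hr.le,
        inv_mul_le_one₀ hr, card, card,
        Function.support_const_smul_of_ne_zero _ _ (inv_ne_zero hr.ne'), and_comm]
    rw [h1, convexHull_smul]
    ext x
    rw [Set.mem_smul_set_iff_inv_smul_mem₀ hr.ne', Set.mem_ofPred_eq, cNorm,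
      ← hC.isClosed.closure_eq, ← gauge_le_one_iff_mem_closure (convex_convexHull ℝ _) hnhds,
      hC.isClosed.closure_eq, gauge_smul_of_nonneg (inv_nonneg.2 hr.le), smul_eq_mul,
      inv_mul_le_one₀ hr]

/-- Each of the `K` rows contributes at most one nonzero column. -/
theorem card_sum_isPartialPerm_le {K : ℕ} {B : Matrix (Fin K) (Fin p) ℝ} (hB : IsPartialPerm B) :
    card (fun j => ∑ i, B i j) ≤ K := by
  classical
  obtain ⟨π, hπ⟩ := hB
  have : Function.support (fun j => ∑ i, B i j) ⊆
      ⋃ i : Fin K, {j | π (Sum.inl i) = Sum.inr j} := by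
    intro j hj
    obtain ⟨i, -, hi⟩ := Finset.exists_ne_zero_of_sum_ne_zero hj
    rw [hπ] at hi
    exact Set.mem_iUnion.2 ⟨i, by simpa using hi⟩
  calc card (fun j => ∑ i, B i j) ≤ (⋃ i : Fin K, {j | π (Sum.inl i) = Sum.inr j}).ncard :=
        Set.ncard_le_ncard this (Set.toFinite _)
    _ ≤ ∑ i : Fin K, {j | π (Sum.inl i) = Sum.inr j}.ncard := Set.ncard_iUnion_le_of_fintype _
    _ ≤ ∑ _i : Fin K, 1 := by
        refine Finset.sum_le_sum fun i _ => (Set.ncard_le_one (Set.toFinite _)).2 ?_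
        intro a ha b hb
        exact Sum.inr_injective (ha.symm.trans hb)
    _ = K := by simp

theorem sum_isPartialPerm_mem_Icc {ι κ : Type*} [Fintype ι] [DecidableEq ι] [DecidableEq κ]
    {B : Matrix ι κ ℝ} (hB : IsPartialPerm B) (j : κ) : ∑ i, B i j ∈ Set.Icc (0 : ℝ) 1 := by
  obtain ⟨π, hπ⟩ := hB
  simp only [hπ, Finset.sum_boole]
  refine ⟨Nat.cast_nonneg _, Nat.cast_le_one.2 (Finset.card_le_one.2 fun a ha b hb => ?_)⟩
  simp only [Finset.mem_filter, Finset.mem_univ, true_and] at ha hb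
  exact Sum.inl_injective (π.injective (ha.trans hb.symm))

/-- The convex hull of the `K`-sparse vectors of a cube. -/
theorem convexHull_card_le_abs_le (hp : 0 < p) (K : ℕ) (r : ℝ) :
    convexHull ℝ {x : Fin p → ℝ | card x ≤ K ∧ ∀ i, |x i| ≤ r} =
      {x | ∑ i, |x i| ≤ r * K ∧ ∀ i, |x i| ≤ r} := by
  refine (convexHull_min ?_ ?_).antisymm ?_
  · rintro x ⟨hx, hxr⟩
    have hr : 0 ≤ r := (abs_nonneg _).trans (hxr ⟨0, hp⟩)
    refine ⟨?_, hxr⟩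
    have hs := (Function.support x).toFinite
    calc ∑ i, |x i| = ∑ i ∈ hs.toFinset, |x i| := by
          refine (Finset.sum_subset (Finset.subset_univ _) fun i _ hi => ?_).symm
          simpa using hi
      _ ≤ hs.toFinset.card • r := Finset.sum_le_card_nsmul _ _ _ fun i _ => hxr i
      _ ≤ r * K := by
          rw [nsmul_eq_mul, mul_comm, ← Set.ncard_eq_toFinset_card]
          exact mul_le_mul_of_nonneg_left (Nat.cast_le.2 hx) hr
  · intro x hx y hy a b ha hb hab
    have h : ∀ i, |(a • x + b • y) i| ≤ a * |x i| + b * |y i| := fun i => by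
      refine (abs_add_le _ _).trans (le_of_eq ?_)
      simp [abs_mul, abs_of_nonneg, ha, hb]
    refine ⟨(Finset.sum_le_sum fun i _ => h i).trans ?_, fun i => (h i).trans ?_⟩
    · rw [Finset.sum_add_distrib, ← Finset.mul_sum, ← Finset.mul_sum]
      calc _ ≤ a * (r * K) + b * (r * K) := by gcongr; exacts [hx.1, hy.1]
        _ = r * K := by rw [← add_mul, hab, one_mul]
    · calc _ ≤ a * r + b * r := by gcongr; exacts [hx.2 i, hy.2 i]
        _ = r := by rw [← add_mul, hab, one_mul]
  · rintro x ⟨hx, hxr⟩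
    have hr : 0 ≤ r := (abs_nonneg _).trans (hxr ⟨0, hp⟩)
    -- The construction below divides by `r * K`; if this is zero, then `x = 0`.
    by_cases h0 : r * K = 0
    · have hx0 : ∀ i, x i = 0 := fun i => by
        have := (Finset.sum_eq_zero_iff_of_nonneg fun i _ => abs_nonneg (x i)).1
          (le_antisymm (h0 ▸ hx) (Finset.sum_nonneg fun i _ => abs_nonneg (x i))) i
          (Finset.mem_univ i)
        exact abs_eq_zero.1 this
      refine subset_convexHull ℝ _ ⟨?_, hxr⟩
      exact (card_le_card_of_support_subset (T := ∅) fun i _ => hx0 i).trans (Nat.zero_le _)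
    have hr' : 0 < r := hr.lt_of_ne' (left_ne_zero_of_mul h0)
    have hK : (0 : ℝ) < K := (Nat.cast_nonneg K).lt_of_ne' (right_ne_zero_of_mul h0)
    let L : Matrix (Fin K) (Fin p) ℝ →ₗ[ℝ] (Fin p → ℝ) :=
      { toFun := fun B j => r * SignType.sign (x j) * ∑ i, B i j
        map_add' := fun B C => by ext j; simp [mul_add, Finset.sum_add_distrib]
        map_smul' := fun c B => by ext j; simp [← Finset.mul_sum]; ring }
    -- All `K` rows equal `|x j| / (r * K)`: the bound on `∑ i, |x i|` controls the row sums, and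
    -- `|x j| ≤ r` the column sums, which are `|x j| / r`.
    have hA := mem_convexHull_isPartialPerm
      (A := (of fun _ j => |x j| / (r * K) : Matrix (Fin K) (Fin p) ℝ))
      (fun i j => by simp only [of_apply]; positivity)
      (fun i => by
        simp only [of_apply]
        rw [← Finset.sum_div]
        exact div_le_one_of_le₀ hx (by positivity))
      (fun j => by
        simp only [of_apply, Finset.sum_const, Finset.card_univ, Fintype.card_fin, nsmul_eq_mul]
        rw [mul_div_assoc', mul_comm r, mul_div_mul_left _ _ hK.ne']
        exact div_le_one_of_le₀ (hxr j) hr)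
    have hL : L (of fun _ j => |x j| / (r * K)) = x := by
      ext j
      simp only [L, LinearMap.coe_mk, AddHom.coe_mk, of_apply, Finset.sum_const, Finset.card_univ,
        Fintype.card_fin, nsmul_eq_mul]
      conv_rhs => rw [← sign_mul_abs (x j)]
      field_simp
    rw [← hL]
    refine convexHull_mono ?_ (L.image_convexHull _ ▸ Set.mem_image_of_mem L hA)
    rintro _ ⟨B, hB, rfl⟩
    refine ⟨le_trans (Set.ncard_le_ncard ?_ (Set.toFinite _)) (card_sum_isPartialPerm_le hB),
      fun j => ?_⟩
    · intro j hj
      exact right_ne_zero_of_mul hj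
    · obtain ⟨h1, h2⟩ := sum_isPartialPerm_mem_Icc hB j
      have h3 : |((SignType.sign (x j) : SignType) : ℝ)| ≤ 1 := by
        rcases lt_trichotomy (x j) 0 with h | h | h <;> simp [h]
      change |r * SignType.sign (x j) * ∑ i, B i j| ≤ r
      rw [abs_mul, abs_mul, abs_of_nonneg hr, abs_of_nonneg h1, mul_assoc]
      exact mul_le_of_le_one_right hr (mul_le_one₀ h3 h1 h2)

end

end SingularHull

/-! ### The three statements. -/

theorem theorem7 (m n : ℕ) (hmn : 0 < min m n) :
    -- the convex hull of a set of pairs described through singular values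
    (∀ (q k : ℕ) (f : Fin k → (Fin (min m n) → ℝ) → (Fin q → ℝ) → ℝ),
      (∀ i z, SingularHull.SignPermInvariant (fun x => f i x z)) →
      convexHull ℝ {w : Matrix (Fin m) (Fin n) ℝ × (Fin q → ℝ) |
          ∀ i, f i (SingularHull.sigma w.1) w.2 ≤ 1} =
        {w : Matrix (Fin m) (Fin n) ℝ × (Fin q → ℝ) |
          (SingularHull.sigma w.1, w.2) ∈
            convexHull ℝ {v : (Fin (min m n) → ℝ) × (Fin q → ℝ) |
              ∀ i, f i v.1 v.2 ≤ 1}}) ∧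
    -- rank constraint and a ball of a sign- and permutation-invariant norm
    (∀ s : Seminorm ℝ (Fin (min m n) → ℝ), (∀ x, s x = 0 → x = 0) →
      SingularHull.SignPermInvariant s → ∀ (K : ℕ), 1 ≤ K → ∀ r : ℝ,
      convexHull ℝ {M : Matrix (Fin m) (Fin n) ℝ |
          M.rank ≤ K ∧ s (SingularHull.sigma M) ≤ r} =
        {M : Matrix (Fin m) (Fin n) ℝ | SingularHull.cNorm s K (SingularHull.sigma M) ≤ r}) ∧
    -- rank constraint and a ball of the spectral norm
    (∀ (K : ℕ) (r : ℝ),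
      convexHull ℝ {M : Matrix (Fin m) (Fin n) ℝ |
          M.rank ≤ K ∧ SingularHull.spectralNorm M ≤ r} =
        {M : Matrix (Fin m) (Fin n) ℝ |
          SingularHull.nuclearNorm M ≤ r * K ∧ SingularHull.spectralNorm M ≤ r}) := by
  refine ⟨fun q k f hf => ?_, fun s hs hinv K hK r => ?_, fun K r => ?_⟩
  · refine SingularHull.InvariantSet.convexHull_sigma_prod
      (S := {v : (Fin (min m n) → ℝ) × (Fin q → ℝ) | ∀ i, f i v.1 v.2 ≤ 1}) ?_
    exact fun π x y z h hy i => ((hf i z).apply_eq π h).trans_le (hy i)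
  · have h := SingularHull.convexHull_sigma_mem (m := m) (n := n)
      (A := {x | SingularHull.card x ≤ K ∧ s x ≤ r}) fun π x y h hy =>
        ⟨(SingularHull.card_eq_of_abs_eq π h).trans_le hy.1, (hinv.apply_eq π h).trans_le hy.2⟩
    rw [SingularHull.convexHull_card_le_seminorm_le hmn hs hK] at h
    simpa only [Set.mem_ofPred_eq, SingularHull.card_sigma] using h
  -- Absolute values make the cube sign-invariant; they disappear on `sigma M`, which is
  -- nonnegative.
  · have h := SingularHull.convexHull_sigma_mem (m := m) (n := n)
      (A := {x | SingularHull.card x ≤ K ∧ ∀ i, |x i| ≤ r}) fun π x y h hy =>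
        ⟨(SingularHull.card_eq_of_abs_eq π h).trans_le hy.1, fun i => (h i).trans_le (hy.2 (π i))⟩
    rw [SingularHull.convexHull_card_le_abs_le hmn] at h
    simp only [SingularHull.nuclearNorm]
    simpa only [Set.mem_ofPred_eq, SingularHull.card_sigma, ← SingularHull.spectralNorm_le_iff hmn,
      abs_of_nonneg (SingularHull.sigma_nonneg _ _)] using h
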